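/- For $n\ge 0$ let $\mathcal H_n=(\mathbb C^2)^{\otimes n}$. For a Hermitian operator $H$ on $\mathcal H_n$ define the quantum Lipschitz constant $$\|H\|_L = 2\max_{1\le i\le n}\ \min_{A}\ \|H - I_i\otimes A\|_\infty ,$$ where $\|\cdot\|_\infty$ is the operator norm, $I_i$ is the identity on the $i$-th qubit, $A$ runs over the Hermitian operators on the other $n-1$ qubits, and the maximum over an empty set is $0$. For density operators (positive semidefinite operators of trace one) $\rho,\sigma$ on $\mathcal H_n$ let $$\|\rho-\sigma\|_{W_1} = \max\{\operatorname{Tr}[H(\rho-\sigma)] : H=H^\dagger,\ \|H\|_L\le 1\}$$ be their quantum Wasserstein distance of order 1, and let $$F(\rho,\sigma) = \Bigl(\operatorname{Tr}\sqrt{\sqrt{\rho}\,\sigma\sqrt{\rho}}\Bigr)^2$$ be their Uhlmann fidelity. Let $\rho$ and $\sigma$ be $n$-qubit mixed states (density operators on $\mathcal H_n$) with $\|\rho-\sigma\|_{W_1}\le 1$. Then $$F(\rho,\sigma)\ \ge\ \bigl(1-\|\rho-\sigma\|_{W_1}\bigr)^2\ \ge\ 1-2\|\rho-\sigma\|_{W_1},$$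 and in particular $2\|\rho-\sigma\|_{W_1}\ge 1-F(\rho,\sigma)$. -/

import Mathlib

open scoped MatrixOrder ComplexOrder

namespace QW

/-- Computational basis labels of the qubits indexed by `ι`. The Hilbert space of these qubits is
`(ℂ²)^{⊗ι} = ℂ^(Bits ι)`; for `n` qubits `ι = Fin n`. -/
abbrev Bits (ι : Type) : Type := ι → Fin 2

/-- Linear operators on the Hilbert space of the qubits indexed by `ι`, as matrices in the
computational basis. -/
abbrev Op (ι : Type) : Type := Matrix (Bits ι) (Bits ι) ℂ

/-- Density operators (mixed states): positive semidefinite of trace one. -/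
structure IsDensity {ι : Type} [Fintype ι] [DecidableEq ι] (ρ : Op ι) : Prop where
  posSemidef : ρ.PosSemidef
  trace_eq_one : ρ.trace = 1

/-- The operator norm `‖A‖_∞` with respect to the Euclidean (Hilbert space) norm. -/
noncomputable def opNorm {ι : Type} [Fintype ι] [DecidableEq ι] (A : Op ι) : ℝ :=
  ‖Matrix.toEuclideanCLM (𝕜 := ℂ) A‖

/-- The operator `I_i ⊗ A` on `n` qubits, where `I_i` is the identity on qubit `i` and `A` acts on
the other `n - 1` qubits. -/
def idTensor {n : ℕ} (i : Fin n) (A : Op {j : Fin n // j ≠ i}) : Op (Fin n) :=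
  Matrix.of fun x y => if x i = y i then A (fun j => x j) (fun j => y j) else 0

/-- The quantum Lipschitz constant
`‖H‖_L = 2 max_i min_A ‖H - I_i ⊗ A‖_∞`,
where `A` runs over the observables of the qubits other than `i`. -/
noncomputable def lipschitzConst {n : ℕ} (H : Op (Fin n)) : ℝ :=
  2 * ⨆ i : Fin n, ⨅ A : {A : Op {j : Fin n // j ≠ i} // A.IsHermitian},
    opNorm (H - idTensor i A.1)

/-- The values `Tr[H X]` for observables `H` with `‖H‖_L ≤ 1`. -/
def w1Values {n : ℕ} (X : Op (Fin n)) : Set ℝ :=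
  {t | ∃ H : Op (Fin n), H.IsHermitian ∧ lipschitzConst H ≤ 1 ∧ t = (H * X).trace.re}

/-- The quantum Wasserstein distance of order 1,
`W₁(ρ, σ) = ‖ρ - σ‖_{W₁} = max {Tr[H (ρ - σ)] : H observable, ‖H‖_L ≤ 1}`. -/
noncomputable def w1Dist {n : ℕ} (ρ σ : Op (Fin n)) : ℝ :=
  sSup (w1Values (ρ - σ))

/-- The Uhlmann fidelity `F(ρ, σ) = (Tr √(√ρ σ √ρ))²`. -/
noncomputable def fidelity {ι : Type} [Fintype ι] [DecidableEq ι] (ρ σ : Op ι) : ℝ :=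
  (CFC.sqrt (CFC.sqrt ρ * σ * CFC.sqrt ρ)).trace.re ^ 2

/-! The supremum in the definition of `w1Dist` is taken over a non-empty set that is bounded
above, so it is a genuine supremum. -/

theorem norm_entry_le_opNorm {ι : Type} [Fintype ι] [DecidableEq ι] (A : Op ι) (x y : Bits ι) :
    ‖A x y‖ ≤ opNorm A := by
  have h1 := (Matrix.toEuclideanCLM (𝕜 := ℂ) A).le_opNorm (EuclideanSpace.single y (1 : ℂ))
  have h2 := PiLp.norm_apply_le
    (Matrix.toEuclideanCLM (𝕜 := ℂ) A (EuclideanSpace.single y (1 : ℂ))) x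
  have h3 : (Matrix.toEuclideanCLM (𝕜 := ℂ) A (EuclideanSpace.single y (1 : ℂ))) x = A x y := by
    simp [Matrix.ofLp_toEuclideanCLM]
  rw [h3] at h2
  have h4 : ‖EuclideanSpace.single y (1 : ℂ)‖ = 1 := by simp
  rw [h4, mul_one] at h1
  exact h2.trans h1

theorem exists_close_of_lipschitzConst_le {n : ℕ} {H : Op (Fin n)} (hH : lipschitzConst H ≤ 1)
    (i : Fin n) : ∃ A : Op {j : Fin n // j ≠ i}, opNorm (H - idTensor i A) ≤ 1 := by
  have : Nonempty {A : Op {j : Fin n // j ≠ i} // A.IsHermitian} :=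
    ⟨⟨0, Matrix.isHermitian_zero⟩⟩
  have h1 := le_ciSup (f := fun i : Fin n =>
    ⨅ A : {A : Op {j : Fin n // j ≠ i} // A.IsHermitian}, opNorm (H - idTensor i A.1))
    (Set.finite_range _).bddAbove i
  unfold lipschitzConst at hH
  obtain ⟨A, hA⟩ := exists_lt_of_ciInf_lt (f := fun A : {A : Op {j : Fin n // j ≠ i} //
    A.IsHermitian} => opNorm (H - idTensor i A.1)) (a := 1) (by linarith)
  exact ⟨A.1, hA.le⟩

theorem norm_offDiag_le {n : ℕ} {H : Op (Fin n)} (hH : lipschitzConst H ≤ 1)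
    {x y : Bits (Fin n)} (hxy : x ≠ y) : ‖H x y‖ ≤ 1 := by
  obtain ⟨i, hi⟩ := Function.ne_iff.1 hxy
  obtain ⟨A, hA⟩ := exists_close_of_lipschitzConst_le hH i
  have h := (norm_entry_le_opNorm (H - idTensor i A) x y).trans hA
  simpa [idTensor, hi] using h

theorem norm_diag_sub_le {n : ℕ} {H : Op (Fin n)} (hH : lipschitzConst H ≤ 1)
    (s : Finset (Fin n)) : ∀ x y : Bits (Fin n), (∀ j, j ∉ s → x j = y j) →
    ‖H x x - H y y‖ ≤ 2 * s.card := by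
  induction s using Finset.induction_on with
  | empty =>
    intro x y h
    have : x = y := funext fun j => h j (by simp)
    simp [this]
  | insert i s hi ih =>
    intro x y h
    obtain ⟨A, hA⟩ := exists_close_of_lipschitzConst_le hH i
    set z : Bits (Fin n) := Function.update x i (y i) with hz
    have h1 := (norm_entry_le_opNorm (H - idTensor i A) x x).trans hA
    have h2 := (norm_entry_le_opNorm (H - idTensor i A) z z).trans hA
    have hr : (fun j : {j : Fin n // j ≠ i} => z j) =
        fun j : {j : Fin n // j ≠ i} => x j := by
      funext j
      simp [hz, Function.update_of_ne j.2]
    have h3 : idTensor i A x x = idTensor i A z z := by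
      simp only [idTensor, Matrix.of_apply, if_true]
      rw [hr]
    have h4 := ih z y (by
      intro j hj
      by_cases hji : j = i
      · subst hji; simp [hz]
      · rw [hz, Function.update_of_ne hji]
        exact h j (by simp [hji, hj]))
    rw [Matrix.sub_apply] at h1 h2
    rw [← h3, norm_sub_rev] at h2
    have h5 : H x x - H y y = (H x x - idTensor i A x x) + (idTensor i A x x - H z z)
        + (H z z - H y y) := by ring
    have h6 := norm_add₃_le (a := H x x - idTensor i A x x) (b := idTensor i A x x - H z z)
      (c := H z z - H y y)
    rw [h5, Finset.card_insert_of_notMem hi]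
    push_cast
    linarith

theorem w1Values_nonempty {n : ℕ} (X : Op (Fin n)) : (w1Values X).Nonempty := by
  refine ⟨0, 0, Matrix.isHermitian_zero, ?_, by simp⟩
  have h : ∀ i : Fin n, ⨅ A : {A : Op {j : Fin n // j ≠ i} // A.IsHermitian},
      opNorm (0 - idTensor i A.1) ≤ 0 := by
    intro i
    refine (ciInf_le ⟨0, ?_⟩ ⟨0, Matrix.isHermitian_zero⟩).trans (le_of_eq ?_)
    · rintro _ ⟨A, rfl⟩
      exact norm_nonneg _
    · have : idTensor i (0 : Op {j : Fin n // j ≠ i}) = 0 := by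
        ext x y; simp [idTensor]
      simp [this, opNorm]
  have := Real.iSup_le h le_rfl
  unfold lipschitzConst
  linarith

theorem bddAbove_w1Values {n : ℕ} (X : Op (Fin n)) (hX : X.trace = 0) :
    BddAbove (w1Values X) := by
  refine ⟨∑ x, ∑ y, (2 * n + 1) * ‖X y x‖, ?_⟩
  rintro _ ⟨H, -, hL, rfl⟩
  have h1 : (H * X).trace = ((H - H 0 0 • (1 : Op (Fin n))) * X).trace := by
    rw [sub_mul, Matrix.trace_sub]
    simp [hX]
  rw [h1]
  refine (Complex.re_le_norm _).trans ?_
  simp only [Matrix.trace, Matrix.diag_apply, Matrix.mul_apply]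
  refine (norm_sum_le _ _).trans (Finset.sum_le_sum fun x _ => ?_)
  refine (norm_sum_le _ _).trans (Finset.sum_le_sum fun y _ => ?_)
  rw [norm_mul]
  refine mul_le_mul_of_nonneg_right ?_ (norm_nonneg _)
  by_cases hxy : x = y
  · subst hxy
    have := norm_diag_sub_le hL Finset.univ x 0 (by simp)
    simp at this
    simp
    linarith
  · have := norm_offDiag_le hL hxy
    simp [Matrix.one_apply_ne hxy]
    have : (0 : ℝ) ≤ n := n.cast_nonneg
    linarith

theorem isLUB_w1Dist {n : ℕ} {ρ σ : Op (Fin n)} (hρ : IsDensity ρ) (hσ : IsDensity σ) :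
    IsLUB (w1Values (ρ - σ)) (w1Dist ρ σ) :=
  isLUB_csSup (w1Values_nonempty _) (bddAbove_w1Values _ (by
    rw [Matrix.trace_sub, hρ.trace_eq_one, hσ.trace_eq_one, sub_self]))

end QW

namespace QW

section Trace

variable {m : Type*} [Fintype m] [DecidableEq m]

/-! Both sides are compared with the affinity `Tr √σ √ρ`. The root fidelity is the trace norm of `√σ
√ρ`, hence at least the affinity (`trace_re_le_trace_abs`). Powers–Størmer for `A = √ρ`, `B = √σ`
gives `2 - 2 Tr √σ √ρ = Tr (A - B)² ≤ Tr U(ρ - σ)` with `U` the sign of `A - B`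
(`exists_powers_stormer`). As `U / 2` has Lipschitz constant at most 1, the right side is at most `2
W₁`. So `√F ≥ 1 - W₁`, and squaring finishes. -/

theorem posSemidef_sqrt (A : Matrix m m ℂ) : (CFC.sqrt A).PosSemidef :=
  Matrix.nonneg_iff_posSemidef.1 (CFC.sqrt_nonneg A)

/-- By cyclicity `Tr AB = Tr √A B √A`, the trace of a positive semidefinite matrix. -/
theorem trace_mul_re_nonneg {A B : Matrix m m ℂ} (hA : A.PosSemidef) (hB : B.PosSemidef) :
    0 ≤ (A * B).trace.re := by
  have h := (Complex.le_def.1 (hB.mul_mul_conjTranspose_same (CFC.sqrt A)).trace_nonneg).1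
  rwa [(posSemidef_sqrt A).1.eq, Matrix.trace_mul_comm, ← Matrix.mul_assoc,
    CFC.sqrt_mul_sqrt_self A hA.nonneg] at h

/-- The real part of the trace is at most the trace norm: `Re Tr M ≤ Tr |M|`, where `Q = |M|` is
given by `Q ≥ 0` and `Q² = M† M`. -/
theorem trace_re_le_trace_abs {M Q : Matrix m m ℂ} (hQ : Q.PosSemidef)
    (h : Q * Q = M.conjTranspose * M) : M.trace.re ≤ Q.trace.re := by
  set d := hQ.1.eigenvalues with hd
  set V : Matrix m m ℂ := hQ.1.eigenvectorUnitary.1 with hV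
  have hV1 : V.conjTranspose * V = 1 := Unitary.coe_star_mul_self hQ.1.eigenvectorUnitary
  have hV2 : V * V.conjTranspose = 1 := Unitary.coe_mul_star_self hQ.1.eigenvectorUnitary
  have hspec : Q = V * Matrix.diagonal (fun i => (d i : ℂ)) * V.conjTranspose := by
    conv_lhs => rw [hQ.1.spectral_theorem, Unitary.conjStarAlgAut_apply]
    rfl
  set N := V.conjTranspose * M * V with hN
  have htrM : M.trace = N.trace := by
    rw [hN, Matrix.trace_mul_comm, ← Matrix.mul_assoc, hV2, Matrix.one_mul]
  have htrQ : Q.trace = ∑ i, (d i : ℂ) := by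
    rw [hspec, Matrix.trace_mul_comm, ← Matrix.mul_assoc, hV1, Matrix.one_mul,
      Matrix.trace_diagonal]
  have hNN : N.conjTranspose * N = Matrix.diagonal (fun i => (d i : ℂ) * d i) := by
    calc N.conjTranspose * N
        = V.conjTranspose * M.conjTranspose * (V * V.conjTranspose) * M * V := by
          simp only [hN, Matrix.conjTranspose_mul, Matrix.conjTranspose_conjTranspose,
            Matrix.mul_assoc]
      _ = V.conjTranspose * (Q * Q) * V := by
          rw [hV2, h]; simp only [Matrix.mul_one, Matrix.mul_assoc]
      _ = (V.conjTranspose * V) * Matrix.diagonal (fun i => (d i : ℂ)) * (V.conjTranspose * V)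
          * Matrix.diagonal (fun i => (d i : ℂ)) * (V.conjTranspose * V) := by
          rw [hspec]; simp only [Matrix.mul_assoc]
      _ = _ := by
          simp [hV1, Matrix.diagonal_mul_diagonal]
  -- In an eigenbasis of `Q`, column `i` of `N` has Euclidean norm `d i`, which bounds its diagonal
  -- entry.
  have hcol : ∀ i, ‖N i i‖ ≤ d i := by
    intro i
    have h0 : 0 ≤ d i := hQ.eigenvalues_nonneg i
    have h1 : ∑ j, ‖N j i‖ ^ 2 = d i ^ 2 := by
      have := congrFun (congrFun hNN i) i
      simp only [Matrix.mul_apply, Matrix.conjTranspose_apply, Matrix.diagonal_apply_eq] at this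
      have h2 : ∀ j, star (N j i) * N j i = ((‖N j i‖ ^ 2 : ℝ) : ℂ) := by
        intro j
        rw [Complex.star_def, Complex.conj_mul']
        push_cast; rfl
      simp only [h2] at this
      rw [sq (d i)]
      exact_mod_cast this
    have h2 : ‖N i i‖ ^ 2 ≤ d i ^ 2 := by
      rw [← h1]
      exact Finset.single_le_sum (f := fun j => ‖N j i‖ ^ 2) (fun j _ => by positivity)
        (Finset.mem_univ i)
    exact (sq_le_sq₀ (norm_nonneg _) h0).1 h2
  rw [htrM, htrQ, Matrix.trace, Complex.re_sum, Complex.re_sum]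
  exact Finset.sum_le_sum fun i _ => (Complex.re_le_norm _).trans (hcol i)

open scoped Matrix.Norms.L2Operator in
/-- A sign matrix of a Hermitian matrix `D`: a Hermitian contraction `U` such that `U D = D U`
is an absolute value of `D`. -/
theorem exists_sign {D : Matrix m m ℂ} (hD : D.IsHermitian) :
    ∃ U : Matrix m m ℂ, U.IsHermitian ∧ ‖Matrix.toEuclideanCLM (𝕜 := ℂ) U‖ ≤ 1 ∧
      U * D = D * U ∧ (U * D + D).PosSemidef ∧ (U * D - D).PosSemidef := by
  set d := hD.eigenvalues with hd
  set V : Matrix m m ℂ := hD.eigenvectorUnitary.1 with hV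
  have hV1 : V.conjTranspose * V = 1 := Unitary.coe_star_mul_self hD.eigenvectorUnitary
  have hspec : D = V * Matrix.diagonal (fun i => (d i : ℂ)) * V.conjTranspose := by
    conv_lhs => rw [hD.spectral_theorem, Unitary.conjStarAlgAut_apply]
    rfl
  -- Only `≤` holds in general: for empty `m` the identity has norm 0.
  have hnorm : ‖V‖ ≤ 1 := by
    have h1 := Matrix.l2_opNorm_conjTranspose_mul_self V
    have h2 : ‖(1 : Matrix m m ℂ)‖ ≤ 1 := by
      rw [← Matrix.diagonal_one, Matrix.l2_opNorm_diagonal]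
      exact (pi_norm_le_iff_of_nonneg zero_le_one).2 fun i => by simp
    rw [hV1] at h1
    nlinarith [norm_nonneg V]
  let s : m → ℝ := fun i => if 0 ≤ d i then 1 else -1
  have hmul : ∀ f g : m → ℂ, (V * Matrix.diagonal f * V.conjTranspose) *
      (V * Matrix.diagonal g * V.conjTranspose) =
      V * Matrix.diagonal (fun i => f i * g i) * V.conjTranspose := by
    intro f g
    calc _ = V * Matrix.diagonal f * (V.conjTranspose * V) * Matrix.diagonal g
          * V.conjTranspose := by simp only [Matrix.mul_assoc]
      _ = _ := by
        rw [hV1, Matrix.mul_one, Matrix.mul_assoc V, Matrix.diagonal_mul_diagonal]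
  have hUD : V * Matrix.diagonal (fun i => (s i : ℂ)) * V.conjTranspose * D =
      V * Matrix.diagonal (fun i => (s i : ℂ) * d i) * V.conjTranspose := by
    conv_lhs => rw [hspec]
    exact hmul _ _
  refine ⟨V * Matrix.diagonal (fun i => (s i : ℂ)) * V.conjTranspose, ?_, ?_, ?_, ?_, ?_⟩
  · refine Matrix.isHermitian_mul_mul_conjTranspose V ?_
    refine Matrix.isHermitian_diagonal_of_self_adjoint _ ?_
    ext i; simp
  · rw [Matrix.l2_opNorm_toEuclideanCLM]
    have h1 := Matrix.l2_opNorm_mul (V * Matrix.diagonal (fun i => (s i : ℂ))) V.conjTranspose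
    have h2 := Matrix.l2_opNorm_mul V (Matrix.diagonal (fun i => (s i : ℂ)))
    have h3 : ‖(Matrix.diagonal (fun i => (s i : ℂ)) : Matrix m m ℂ)‖ ≤ 1 := by
      rw [Matrix.l2_opNorm_diagonal]
      refine (pi_norm_le_iff_of_nonneg zero_le_one).2 fun i => ?_
      by_cases h : 0 ≤ d i <;> simp [s, h]
    rw [Matrix.l2_opNorm_conjTranspose] at h1
    have h4 := mul_le_one₀ hnorm (norm_nonneg _) h3
    exact h1.trans (mul_le_one₀ (h2.trans h4) (norm_nonneg _) hnorm)
  · rw [hUD]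
    conv_rhs => rw [hspec]
    rw [hmul]
    simp only [mul_comm]
  · rw [hUD]
    conv in _ + D => rw [hspec]
    rw [← Matrix.add_mul, ← Matrix.mul_add, Matrix.diagonal_add]
    refine Matrix.PosSemidef.mul_mul_conjTranspose_same ?_ V
    rw [Matrix.posSemidef_diagonal_iff]
    intro i
    have : 0 ≤ s i * d i + d i := by
      by_cases h : 0 ≤ d i <;> simp [s, h]
    exact_mod_cast this
  · rw [hUD]
    conv in _ - D => rw [hspec]
    rw [← Matrix.sub_mul, ← Matrix.mul_sub, Matrix.diagonal_sub]
    refine Matrix.PosSemidef.mul_mul_conjTranspose_same ?_ V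
    rw [Matrix.posSemidef_diagonal_iff]
    intro i
    have : 0 ≤ s i * d i - d i := by
      by_cases h : 0 ≤ d i
      · simp [s, h]
      · simp only [s, h, if_false]; linarith
    exact_mod_cast this

/-- The Powers–Størmer inequality, with the observable that witnesses the trace norm. -/
theorem exists_powers_stormer {A B : Matrix m m ℂ} (hA : A.PosSemidef) (hB : B.PosSemidef) :
    ∃ U : Matrix m m ℂ, U.IsHermitian ∧ ‖Matrix.toEuclideanCLM (𝕜 := ℂ) U‖ ≤ 1 ∧
      (A * A).trace.re + (B * B).trace.re - 2 * (B * A).trace.re ≤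
        (U * (A * A - B * B)).trace.re := by
  obtain ⟨U, hU, hn, hc, hp, hm⟩ := exists_sign (hA.1.sub hB.1)
  refine ⟨U, hU, hn, ?_⟩
  -- With `D = A - B`, adding `Tr (UD + D)B ≥ 0` and `Tr (UD - D)A ≥ 0` gives `Tr UD(A + B) ≥ Tr
  -- D²`.
  have h1 := trace_mul_re_nonneg hp hB
  have h2 := trace_mul_re_nonneg hm hA
  have hAB : (A * B).trace.re = (B * A).trace.re := by rw [Matrix.trace_mul_comm]
  -- Since `U` commutes with `A - B`, the cross terms of `U(A - B)(A + B)` cancel under the trace,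
  -- leaving `Tr U(A² - B²)`.
  have e1 : (U * (A * B)).trace = (U * (B * A)).trace := by
    have := congrArg (fun X => (X * A).trace) hc
    simp only [mul_sub, sub_mul, Matrix.trace_sub] at this
    rw [Matrix.mul_assoc, Matrix.mul_assoc, Matrix.mul_assoc, Matrix.mul_assoc,
      Matrix.trace_mul_comm A, Matrix.trace_mul_comm B, Matrix.mul_assoc, Matrix.mul_assoc] at this
    linear_combination this
  simp only [mul_sub, sub_mul, add_mul, Matrix.trace_sub, Matrix.trace_add, Complex.sub_re,
    Complex.add_re, Matrix.mul_assoc] at h1 h2 ⊢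
  rw [e1] at h1
  linarith

end Trace

theorem opNorm_smul {ι : Type} [Fintype ι] [DecidableEq ι] (c : ℂ) (A : Op ι) :
    opNorm (c • A) = ‖c‖ * opNorm A := by
  rw [opNorm, opNorm, map_smul, norm_smul]

/-- The quantum Lipschitz constant is at most twice the operator norm. -/
theorem lipschitzConst_le {n : ℕ} (H : Op (Fin n)) : lipschitzConst H ≤ 2 * opNorm H := by
  refine mul_le_mul_of_nonneg_left (Real.iSup_le (fun i => ?_) (norm_nonneg _)) zero_le_two
  refine (ciInf_le ⟨0, ?_⟩ ⟨0, Matrix.isHermitian_zero⟩).trans (le_of_eq ?_)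
  · rintro _ ⟨A, rfl⟩
    exact norm_nonneg _
  · have : idTensor i (0 : Op {j : Fin n // j ≠ i}) = 0 := by
      ext x y; simp [idTensor]
    simp [this]

/-- The root fidelity dominates the affinity `Tr √σ √ρ`. -/
theorem affinity_le_trace_sqrt {ι : Type} [Fintype ι] [DecidableEq ι] {ρ σ : Op ι}
    (hσ : σ.PosSemidef) :
    (CFC.sqrt σ * CFC.sqrt ρ).trace.re ≤
      (CFC.sqrt (CFC.sqrt ρ * σ * CFC.sqrt ρ)).trace.re := by
  have hr : (CFC.sqrt ρ).IsHermitian := (posSemidef_sqrt ρ).1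
  have hs : (CFC.sqrt σ).IsHermitian := (posSemidef_sqrt σ).1
  have key : CFC.sqrt ρ * σ * CFC.sqrt ρ =
      (CFC.sqrt σ * CFC.sqrt ρ).conjTranspose * (CFC.sqrt σ * CFC.sqrt ρ) := by
    rw [Matrix.conjTranspose_mul, hr.eq, hs.eq]
    conv_lhs => rw [← CFC.sqrt_mul_sqrt_self σ hσ.nonneg]
    simp only [Matrix.mul_assoc]
  refine trace_re_le_trace_abs (posSemidef_sqrt _) ?_
  rw [key]
  exact CFC.sqrt_mul_sqrt_self _ (Matrix.posSemidef_conjTranspose_mul_self _).nonneg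

/-- The Powers–Størmer witness `U`, halved to offset the factor 2 in `lipschitzConst_le`, is
admissible in the supremum defining `W₁`. -/
theorem one_sub_affinity_le_w1Dist {n : ℕ} {ρ σ : Op (Fin n)} (hρ : IsDensity ρ)
    (hσ : IsDensity σ) : 1 - (CFC.sqrt σ * CFC.sqrt ρ).trace.re ≤ w1Dist ρ σ := by
  obtain ⟨U, hU, hn, h⟩ := exists_powers_stormer (posSemidef_sqrt ρ)
    (posSemidef_sqrt σ)
  rw [CFC.sqrt_mul_sqrt_self ρ hρ.posSemidef.nonneg,
    CFC.sqrt_mul_sqrt_self σ hσ.posSemidef.nonneg, hρ.trace_eq_one, hσ.trace_eq_one,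
    Complex.one_re] at h
  have hmem : (((1 / 2 : ℝ) : ℂ) • U * (ρ - σ)).trace.re ∈ w1Values (ρ - σ) := by
    refine ⟨_, ?_, ?_, rfl⟩
    · rw [Matrix.IsHermitian, Matrix.conjTranspose_smul, hU.eq, Complex.star_def,
        Complex.conj_ofReal]
    · refine (lipschitzConst_le _).trans ?_
      rw [opNorm_smul, Complex.norm_real]
      have : opNorm U ≤ 1 := hn
      norm_num
      linarith
  have hle := (isLUB_w1Dist hρ hσ).1 hmem
  rw [Matrix.smul_mul, Matrix.trace_smul, smul_eq_mul, Complex.re_ofReal_mul] at hle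
  linarith

end QW

theorem mainTheorem3 (n : ℕ) (ρ σ : QW.Op (Fin n)) (hρ : QW.IsDensity ρ) (hσ : QW.IsDensity σ)
    (hW : QW.w1Dist ρ σ ≤ 1) :
    (1 - QW.w1Dist ρ σ) ^ 2 ≤ QW.fidelity ρ σ ∧
      1 - 2 * QW.w1Dist ρ σ ≤ (1 - QW.w1Dist ρ σ) ^ 2 ∧
      1 - QW.fidelity ρ σ ≤ 2 * QW.w1Dist ρ σ := by
  have h1 : (1 - QW.w1Dist ρ σ) ^ 2 ≤ QW.fidelity ρ σ := by
    -- The hypothesis `hW` makes `1 - W₁` nonnegative, so squaring preserves the inequality.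
    refine pow_le_pow_left₀ (by linarith) ?_ 2
    linarith [QW.one_sub_affinity_le_w1Dist hρ hσ,
      QW.affinity_le_trace_sqrt (ρ := ρ) hσ.posSemidef]
  have h2 : 1 - 2 * QW.w1Dist ρ σ ≤ (1 - QW.w1Dist ρ σ) ^ 2 := by
    linarith [sq_nonneg (QW.w1Dist ρ σ)]
  exact ⟨h1, h2, by linarith⟩
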